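/- All graphs are finite, simple, undirected and connected. A graph $G$ is a split graph if $V(G)$ can be partitioned into a clique and an independent set. For a positive integer $t$, a tree $t$-spanner of $G$ is a spanning tree $T$ of $G$ such that any two vertices adjacent in $G$ are at distance at most $t$ in $T$; the stretch index $\sigma(G)$ is the smallest $t$ for which $G$ has a tree $t$-spanner. Let $\Delta(G)$ be the maximum degree of $G$. The graph $G$ is Class 1 if its edges can be properly coloured with $\Delta(G)$ colours, and Class 2 otherwise. It is overfull if $|E(G)|>\Delta(G)\cdot\lfloor |V(G)|/2\rfloor$, and subgraph-overfull if it has a subgraph $H\subseteq G$ with $\Delta(H)=\Delta(G)$ that is overfull. Every split graph $G$ with $\sigma(G)=2$ satisfies the conjecture of Figueiredo et al. on chordal graphs, that is, $G$ is Class 2 if and only if $G$ is subgraph-overfull. -/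

import Mathlib

namespace SplitEdgeColoring

universe u

variable {V : Type u}

/-- `G` is a split graph: its vertex set is partitioned into a clique `X` and an independent
set `Xᶜ`. -/
def IsSplit (G : SimpleGraph V) : Prop :=
  ∃ X : Set V, G.IsClique X ∧ G.IsIndepSet Xᶜ

/-- `T` is a tree `t`-spanner of `G`: a spanning tree of `G` in which any two vertices that are
adjacent in `G` are at distance at most `t`. -/
def IsTreeSpanner (G : SimpleGraph V) (t : ℕ) (T : SimpleGraph V) : Prop :=
  T ≤ G ∧ T.IsTree ∧ ∀ u v : V, G.Adj u v → T.dist u v ≤ t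

/-- `G` is `t`-admissible: it has a tree `t`-spanner. -/
def IsAdmissible (G : SimpleGraph V) (t : ℕ) : Prop :=
  ∃ T : SimpleGraph V, IsTreeSpanner G t T

/-- The stretch index `σ(G)`: the least `t` for which `G` is `t`-admissible. -/
noncomputable def stretchIndex (G : SimpleGraph V) : ℕ :=
  sInf {t : ℕ | IsAdmissible G t}

open Classical in
/-- `G` is Class 1: its edges can be properly coloured with `Δ(G)` colours. A proper edge
colouring of `G` is a proper vertex colouring of the line graph of `G`. -/
def IsClassOne [Fintype V] (G : SimpleGraph V) : Prop :=
  G.lineGraph.Colorable G.maxDegree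

/-- `G` is Class 2: it is not Class 1. -/
def IsClassTwo [Fintype V] (G : SimpleGraph V) : Prop :=
  ¬ IsClassOne G

open Classical in
/-- `G` is overfull: `|E(G)| > Δ(G) * ⌊|V(G)| / 2⌋`. -/
def IsOverfull [Fintype V] (G : SimpleGraph V) : Prop :=
  G.edgeFinset.card > G.maxDegree * (Fintype.card V / 2)

open Classical in
/-- `G` is subgraph-overfull: it has a subgraph `H` (not necessarily induced or spanning) with
`Δ(H) = Δ(G)` which is overfull. -/
def IsSubgraphOverfull [Fintype V] (G : SimpleGraph V) : Prop :=
  ∃ H : G.Subgraph, H.coe.maxDegree = G.maxDegree ∧ IsOverfull H.coe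

end SplitEdgeColoring

/-! Overfullness obstructs colouring by counting, since colour classes are matchings. For the
converse, a tree 2-spanner squeezes every clique into a star of the tree, and this yields a vertex
`v` adjacent to all others except some of degree at most one (`exists_almost_universal`). Those can
be coloured last, greedily, so only G[W] matters, where W is the closed neighbourhood of `v`. If #W
≤ Δ, or #W = Δ + 1 is even, the complete graph on W already has a Δ-edge-colouring. Otherwise #W =
2m + 1 and Δ = 2m. As G[W] is not overfull, its complement has at least m edges; all of them meet an
independent set of G, so m of them form a graph F inside a set of at most m + 1 vertices. It
suffices to colour K_{2m+1} − F with 2m colours (`exists_dartColoring_top`).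

To this end the 2m orientations of the edges of F receive distinct colours, so that an edge of F
shows a different colour at each end. The colouring extends greedily to a small clique containing F,
and the other vertices are added one at a time by Hall's theorem. Each colour occurs at an odd
number of vertices, and this parity sustains the induction (`DartColoring.exists_insert`). -/

namespace SplitEdgeColoring

variable {V : Type*}

/-! ### Tree 2-spanners of split graphs. -/

section Structure

open SimpleGraph

theorem dist_eq_of_isPath {T : SimpleGraph V} (hT : T.IsTree) {a b : V} (p : T.Walk a b)
    (hp : p.IsPath) : T.dist a b = p.length := by
  obtain ⟨q, hq, hl⟩ := hT.connected.exists_path_of_dist a b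
  rw [← hl]
  have := (hT.isAcyclic.subsingleton_path a b).elim ⟨p, hp⟩ ⟨q, hq⟩
  rw [Subtype.mk.injEq] at this
  rw [this]

theorem dist_eq_two {T : SimpleGraph V} (hT : T.IsTree) {a z b : V} (h₁ : T.Adj a z)
    (h₂ : T.Adj z b) (hab : a ≠ b) : T.dist a b = 2 :=
  dist_eq_of_isPath hT (.cons h₁ (.cons h₂ .nil)) (by
    simp [Walk.cons_isPath_iff, h₁.ne, h₂.ne, hab])

theorem no_triangle {T : SimpleGraph V} (hT : T.IsTree) {a b c : V} (h₁ : T.Adj a b)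
    (h₂ : T.Adj b c) : ¬ T.Adj a c := fun h ↦ by
  have := dist_eq_two hT h₁ h₂ h.ne
  rw [dist_eq_one_iff_adj.2 h] at this
  omega

theorem common_neighbor_unique {T : SimpleGraph V} (hT : T.IsTree) {a b z z' : V} (hab : a ≠ b)
    (h₁ : T.Adj z a) (h₂ : T.Adj z b) (h₁' : T.Adj z' a) (h₂' : T.Adj z' b) : z = z' := by
  have := (hT.isAcyclic.subsingleton_path a b).elim
    ⟨.cons h₁.symm (.cons h₂ .nil), by simp [Walk.cons_isPath_iff, h₁.ne', h₂.ne, hab]⟩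
    ⟨.cons h₁'.symm (.cons h₂' .nil), by simp [Walk.cons_isPath_iff, h₁'.ne', h₂'.ne, hab]⟩
  rw [Subtype.mk.injEq] at this
  have h := congrArg (fun w ↦ w.support) this
  simpa using h

theorem adj_or_common_neighbor {T : SimpleGraph V} (hT : T.IsTree) {a b : V} (hab : a ≠ b)
    (h : T.dist a b ≤ 2) : T.Adj a b ∨ ∃ z, T.Adj z a ∧ T.Adj z b := by
  obtain ⟨p, hp⟩ := hT.connected.exists_walk_length_eq_dist a b
  rw [← hp] at h
  match p, h with
  | .nil, _ => exact absurd rfl hab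
  | .cons h₁ .nil, _ => exact .inl h₁
  | .cons h₁ (.cons h₂ .nil), _ => exact .inr ⟨_, h₁.symm, h₂⟩
  | .cons h₁ (.cons h₂ (.cons h₃ q)), h => simp at h

/-- In a tree, a set of vertices at pairwise distance at most two lies in a closed star. -/
theorem exists_star_center {T : SimpleGraph V} (hT : T.IsTree) (K : Set V)
    (hK : ∀ a ∈ K, ∀ b ∈ K, T.dist a b ≤ 2) : ∃ z, ∀ x ∈ K, x = z ∨ T.Adj z x := by
  by_cases h : ∃ a ∈ K, ∃ b ∈ K, a ≠ b ∧ ¬ T.Adj a b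
  · obtain ⟨a, ha, b, hb, hab, hnadj⟩ := h
    obtain ⟨z, hza, hzb⟩ := (adj_or_common_neighbor hT hab (hK a ha b hb)).resolve_left hnadj
    refine ⟨z, fun c hc ↦ ?_⟩
    -- A vertex `c` off the star would be joined to `b` by a tree path of length three or four
    -- through `a` and `z`.
    by_contra! hcz
    have hca : c ≠ a := by rintro rfl; exact hcz.2 hza
    have hcb : c ≠ b := by rintro rfl; exact hcz.2 hzb
    rcases adj_or_common_neighbor hT hca (hK c hc a ha) with hadj | ⟨r, hrc, hra⟩
    · have := dist_eq_of_isPath hT (.cons hadj (.cons hza.symm (.cons hzb .nil))) (by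
        simp [Walk.cons_isPath_iff, hadj.ne, hza.ne', hzb.ne, hab, hcb, hcz.1])
      have h2 := hK c hc b hb
      simp at this
      omega
    · have hrz : r ≠ z := by rintro rfl; exact hcz.2 hrc
      have hrb : r ≠ b := by rintro rfl; exact hnadj hra.symm
      have := dist_eq_of_isPath hT
        (.cons hrc.symm (.cons hra (.cons hza.symm (.cons hzb .nil)))) (by
        simp [Walk.cons_isPath_iff, hrc.ne', hra.ne, hza.ne', hzb.ne, hab, hca, hcb, hcz.1, hrz,
          hrb])
      have h2 := hK c hc b hb
      simp at this
      omega
  · push Not at h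
    rcases K.eq_empty_or_nonempty with rfl | ⟨z, hz⟩
    · obtain ⟨z⟩ := hT.connected.nonempty
      exact ⟨z, by simp⟩
    · exact ⟨z, fun x hx ↦ or_iff_not_imp_left.2 fun hne ↦ h z hz x hx (Ne.symm hne)⟩

/-- A `2`-admissible split graph has a vertex adjacent to all the others but those of degree
at most one. -/
theorem exists_almost_universal [Finite V] {G : SimpleGraph V} (hsplit : IsSplit G)
    (hadm : IsAdmissible G 2) :
    ∃ v, ∀ u, u = v ∨ G.Adj v u ∨ ∀ a b, G.Adj u a → G.Adj u b → a = b := by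
  obtain ⟨T, hTG, hT, hd⟩ := hadm
  obtain ⟨X, hX⟩ := (Set.toFinite {X : Set V | G.IsClique X ∧ G.IsIndepSet Xᶜ}).exists_maximal
    hsplit
  obtain ⟨⟨hcl, hind⟩, hmax⟩ := hX
  have hclose : ∀ K : Set V, G.IsClique K → ∀ a ∈ K, ∀ b ∈ K, T.dist a b ≤ 2 := by
    intro K hK a ha b hb
    by_cases hab : a = b
    · simp [hab]
    · exact hd a b (hK ha hb hab)
  obtain ⟨v, hv⟩ := exists_star_center hT X (hclose X hcl)
  -- The centre is joined in `T`, hence in `G`, to the whole clique, so maximality puts it in `X`.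
  have hvX : v ∈ X := by
    by_contra hvX
    have hcl' : G.IsClique (insert v X) := by
      refine hcl.insert fun b hb _ ↦ hTG ?_
      exact (hv b hb).resolve_left fun h ↦ hvX (h ▸ hb)
    have hind' : G.IsIndepSet (insert v X)ᶜ :=
      hind.mono (Set.compl_subset_compl.2 (Set.subset_insert v X))
    exact hvX (hmax ⟨hcl', hind'⟩ (Set.subset_insert v X) (Set.mem_insert v X))
  refine ⟨v, fun s ↦ ?_⟩
  by_cases hs : s ∈ X
  · by_cases hsv : s = v
    · exact .inl hsv
    · exact .inr (.inl (hcl hvX hs (Ne.symm hsv)))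
  have hsN : ∀ a, G.Adj s a → a ∈ X := fun a ha ↦ by
    by_contra h
    exact hind hs h ha.ne ha
  refine .inr (or_iff_not_imp_left.2 fun hvs a b ha hb ↦ ?_)
  by_contra hab
  have hnv : ∀ x, G.Adj s x → x ≠ v := fun x hx h ↦ hvs (h ▸ hx.symm)
  have hvadj : ∀ x, G.Adj s x → T.Adj v x := fun x hx ↦
    (hv x (hsN x hx)).resolve_left (hnv x hx)
  have hK : G.IsClique (insert s (G.neighborSet s)) := by
    refine SimpleGraph.IsClique.insert (fun x hx y hy hxy ↦ ?_) fun b hb _ ↦ hb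
    exact hcl (hsN x hx) (hsN y hy) hxy
  -- The closed neighbourhood of `s` has its own star centre `z`. If `z = s`, then `s` and `v` are
  -- two midpoints between `a` and `b`; otherwise any further neighbour of `s` forms a triangle in
  -- `T` with `v` and `z`.
  obtain ⟨z, hz⟩ := exists_star_center hT _ (hclose _ hK)
  by_cases hzs : z = s
  · subst hzs
    have h1 := (hz a (.inr ha)).resolve_left ha.ne'
    have h2 := (hz b (.inr hb)).resolve_left hb.ne'
    have := common_neighbor_unique hT hab h1 h2 (hvadj a ha) (hvadj b hb)
    exact hs (this ▸ hvX)
  · have hzs' := (hz s (.inl rfl)).resolve_left (Ne.symm hzs)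
    have hsz : G.Adj s z := (hTG hzs').symm
    have key : ∀ x, G.Adj s x → x = z := fun x hx ↦ by
      by_contra hne
      exact no_triangle hT (hvadj z hsz) ((hz x (.inr hx)).resolve_left hne) (hvadj x hx)
    exact hab ((key a ha).trans (key b hb).symm)

end Structure

/-! ### Matchings from Hall's theorem. -/

section Matching

open Finset

/-- A nonnegative matrix with all row and column sums equal to `s > 0` has a transversal of
nonzero entries. -/
theorem exists_equiv_ne_zero {R C : Type*} [Fintype R] [Fintype C]
    (hcard : Fintype.card R = Fintype.card C) (M : R → C → ℝ) (h₀ : ∀ r i, 0 ≤ M r i) {s : ℝ}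
    (hs : 0 < s) (hrow : ∀ r, ∑ i, M r i = s) (hcol : ∀ i, ∑ r, M r i = s) :
    ∃ g : R ≃ C, ∀ r, M r (g r) ≠ 0 := by
  classical
  let f : R → Finset C := fun r ↦ {i | M r i ≠ 0}
  have hf : ∀ A : Finset R, #A ≤ #(A.biUnion f) := by
    intro A
    -- Hall's condition by weight: the rows of `A` carry `#A * s`, all of it in columns that hold
    -- only `s` each.
    have h₁ : ∑ r ∈ A, ∑ i ∈ f r, M r i = #A * s := by
      simp [f, sum_subset (subset_univ (f _)), hrow]
    have h₂ : ∑ r, ∑ i ∈ A.biUnion f, M r i = #(A.biUnion f) * s := by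
      rw [sum_comm]
      simp [hcol]
    suffices #A * s ≤ #(A.biUnion f) * s by exact_mod_cast le_of_mul_le_mul_right this hs
    rw [← h₁, ← h₂]
    trans ∑ r ∈ A, ∑ i ∈ A.biUnion f, M r i
    · exact sum_le_sum fun r hr ↦
        sum_le_sum_of_subset_of_nonneg (subset_biUnion_of_mem f hr) fun _ _ _ ↦ h₀ _ _
    · exact sum_le_sum_of_subset_of_nonneg (subset_univ _) fun _ _ _ ↦
        sum_nonneg fun j _ ↦ h₀ _ _
  obtain ⟨g, hg, hg'⟩ := (all_card_le_biUnion_card_iff_exists_injective f).1 hf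
  refine ⟨Equiv.ofBijective g ((Fintype.bijective_iff_injective_and_card g).2 ⟨hg, hcard⟩),
    fun r ↦ ?_⟩
  simpa [f] using hg' r

/-- In a bipartite graph where the vertices of `U` have degree `k` and all other degrees are at
most `k`, and the second side has `#U + k - 1` vertices, some matching covers `U` and all
vertices of degree `k`. -/
theorem exists_injOn_covering {V C : Type*} [Fintype C] [DecidableEq C] (U : Finset V)
    (hU : U.Nonempty) (L : V → Finset C) {k : ℕ} (hk : 0 < k) (hC : Fintype.card C + 1 = #U + k)
    (hrow : ∀ u ∈ U, #(L u) = k) (hcol : ∀ i, #{u ∈ U | i ∈ L u} ≤ k)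
    (hone : k = 1 → ∀ i, #{u ∈ U | i ∈ L u} = 1) :
    ∃ g : V → C, Set.InjOn g U ∧ (∀ u ∈ U, g u ∈ L u) ∧
      ∀ i, #{u ∈ U | i ∈ L u} = k → ∃ u ∈ U, g u = i := by
  classical
  let d : C → ℕ := fun i ↦ #{u ∈ U | i ∈ L u}
  -- The `k - 1` dummy rows make the matrix square and supply in equal shares the weight `k - d i`
  -- that column `i` lacks. They vanish on columns of degree `k`, which a transversal must therefore
  -- meet in a row of `U`. For `k = 1` there are no dummy rows, whence `hone`.
  let M : U ⊕ Fin (k - 1) → C → ℝ := Sum.elim (fun u i ↦ if i ∈ L u then 1 else 0)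
    fun _ i ↦ ((k : ℝ) - d i) / ((k - 1 : ℕ) : ℝ)
  have hsum : ∑ i, (d i : ℝ) = #U * k := by
    have : ∑ i, d i = #U * k := by
      simp only [d, card_filter]
      rw [sum_comm]
      simp only [← card_filter, filter_univ_mem]
      rw [sum_congr rfl hrow]
      simp
    exact_mod_cast this
  suffices ∃ g : U ⊕ Fin (k - 1) ≃ C, ∀ r, M r (g r) ≠ 0 by
    obtain ⟨g, hg⟩ := this
    obtain ⟨u₀, hu₀⟩ := hU
    refine ⟨fun u ↦ if h : u ∈ U then g (.inl ⟨u, h⟩) else g (.inl ⟨u₀, hu₀⟩), ?_, ?_, ?_⟩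
    · intro u hu u' hu' h
      have hu : u ∈ U := hu
      have hu' : u' ∈ U := hu'
      simp only [hu, hu', dif_pos] at h
      simpa using g.injective h
    · intro u hu
      have := hg (.inl ⟨u, hu⟩)
      simpa [hu, M] using this
    · intro i hi
      obtain ⟨r, rfl⟩ := g.surjective i
      rcases r with ⟨u, hu⟩ | j
      · exact ⟨u, hu, by simp [hu]⟩
      · exact absurd (by simp [M, d, hi]) (hg (.inr j))
  refine exists_equiv_ne_zero (s := k) (by simp; omega) M ?_ (by exact_mod_cast hk) ?_ ?_
  · rintro (u | j) i
    · simp only [M, Sum.elim_inl]; positivity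
    · simp only [M, Sum.elim_inr]
      have : (d i : ℝ) ≤ k := by exact_mod_cast hcol i
      exact div_nonneg (by linarith) (by positivity)
  · rintro (u | j)
    · simp [M, hrow u u.2]
    · have hk1 : 0 < k - 1 := j.pos
      have hk' : ((k - 1 : ℕ) : ℝ) ≠ 0 := by exact_mod_cast hk1.ne'
      simp only [M, Sum.elim_inr]
      rw [← sum_div, sum_sub_distrib, hsum, div_eq_iff hk']
      have : (Fintype.card C : ℝ) = #U + (k - 1 : ℕ) := by
        exact_mod_cast (by omega : Fintype.card C = #U + (k - 1))
      simp [this]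
      ring
  · intro i
    have hdeg : ∑ u : U, (if i ∈ L u then (1 : ℝ) else 0) = d i := by
      rw [sum_coe_sort U (fun u ↦ if i ∈ L u then (1 : ℝ) else 0)]
      simp [d]
    simp only [M, Fintype.sum_sum_type, Sum.elim_inl, Sum.elim_inr, hdeg]
    rcases Nat.lt_or_ge 1 k with h | h
    · have hk' : ((k - 1 : ℕ) : ℝ) ≠ 0 := by exact_mod_cast (by omega : k - 1 ≠ 0)
      simp
      field_simp
      ring
    · obtain rfl : k = 1 := by omega
      simp [d, hone rfl i]

end Matching

/-! ### Colouring a complete graph minus a few edges. -/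

section DartColoring

open Finset SimpleGraph

variable {C : Type*}

/-- The graph that is complete on `U` and has no further edges. -/
def cliqueOn (U : Finset V) : SimpleGraph V where
  Adj x y := x ∈ U ∧ y ∈ U ∧ x ≠ y
  symm := ⟨fun _ _ h ↦ ⟨h.2.1, h.1, h.2.2.symm⟩⟩
  loopless := ⟨fun _ h ↦ h.2.2 rfl⟩

@[simp] theorem cliqueOn_adj {U : Finset V} {x y : V} :
    (cliqueOn U).Adj x y ↔ x ∈ U ∧ y ∈ U ∧ x ≠ y := Iff.rfl

/-- A colouring of the ordered edges of `A`, proper at every vertex, which gives both orientations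
of an edge outside `F` the same colour, while the ordered edges of `F` use every colour exactly
once. -/
structure DartColoring (F A : SimpleGraph V) (c : V → V → C) : Prop where
  inj : ∀ x y z, A.Adj x y → A.Adj x z → c x y = c x z → y = z
  symm : ∀ x y, ¬ F.Adj x y → c x y = c y x
  dart : ∀ i, ∃! p : V × V, F.Adj p.1 p.2 ∧ c p.1 p.2 = i

theorem exists_dartColoring_self [Fintype V] [Nonempty C] [Fintype C] (F : SimpleGraph V)
    [Fintype F.edgeSet] (hC : Fintype.card C = 2 * #F.edgeFinset) :
    ∃ c : V → V → C, DartColoring F F c := by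
  classical
  have hcard : Fintype.card F.Dart = Fintype.card C := by
    rw [hC, dart_card_eq_twice_card_edges]
    congr!
  let e : F.Dart ≃ C := Fintype.equivOfCardEq hcard
  have hc : ∀ p : V × V, ∀ h : F.Adj p.1 p.2,
      (if h : F.Adj p.1 p.2 then e ⟨(p.1, p.2), h⟩ else Classical.arbitrary C) = e ⟨p, h⟩ :=
    fun p h ↦ by simp [h]
  -- A constant default value keeps the colouring symmetric off `F`.
  refine ⟨fun x y ↦ if h : F.Adj x y then e ⟨(x, y), h⟩ else Classical.arbitrary C, ?_, ?_, ?_⟩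
  · intro x y z hy hz h
    simpa [hy, hz] using h
  · intro x y h
    simp [h, F.adj_comm y x]
  · intro i
    obtain ⟨⟨p, hp⟩, rfl⟩ := e.surjective i
    refine ⟨p, ⟨hp, hc p hp⟩, fun q hq ↦ ?_⟩
    have h := hq.2
    rw [hc q hq.1, e.injective.eq_iff, Dart.mk.injEq] at h
    exact h

/-- Greedy step: each end of the uncoloured edge meets at most `#U - 2` coloured ones, so at most `2
* #U - 4` colours are blocked, fewer than there are. -/
theorem DartColoring.exists_sup_edge [Fintype V] [Fintype C] {F A : SimpleGraph V}
    {c : V → V → C} (hc : DartColoring F A c) {U : Finset V} (hFA : F ≤ A) (hAU : A ≤ cliqueOn U)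
    (hU : 2 * #U ≤ Fintype.card C + 2) {x y : V} (hx : x ∈ U) (hy : y ∈ U) (hxy : x ≠ y)
    (hA : ¬ A.Adj x y) : ∃ c' : V → V → C, DartColoring F (A ⊔ edge x y) c' := by
  classical
  have hcard : ∀ u v, u ∈ U → v ∈ U → u ≠ v → ¬ A.Adj u v →
      #({z | A.Adj u z} : Finset V) + 2 ≤ #U := by
    intro u v hu hv huv h
    rw [← card_pair huv, ← card_union_of_disjoint]
    · refine card_le_card fun z hz ↦ ?_
      simp only [mem_union, mem_filter_univ, mem_insert, mem_singleton] at hz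
      rcases hz with hz | rfl | rfl
      exacts [(hAU hz).2.1, hu, hv]
    · rw [Finset.disjoint_left]
      intro z hz
      simp only [mem_filter_univ] at hz
      simp only [mem_insert, mem_singleton, not_or]
      exact ⟨hz.ne', fun h' ↦ h (h' ▸ hz)⟩
  obtain ⟨γ, hγ⟩ : ∃ γ, γ ∉ ({z | A.Adj x z} : Finset V).image (c x) ∪
      ({z | A.Adj y z} : Finset V).image (c y) := by
    by_contra! h
    have h1 := card_le_card (fun i _ ↦ h i : (univ : Finset C) ⊆ _)
    have h2 := h1.trans (card_union_le _ _)
    have h3 := card_image_le (s := ({z | A.Adj x z} : Finset V)) (f := c x)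
    have h4 := card_image_le (s := ({z | A.Adj y z} : Finset V)) (f := c y)
    have h5 := hcard x y hx hy hxy hA
    have h6 := hcard y x hy hx hxy.symm fun h ↦ hA h.symm
    rw [card_univ] at h2
    omega
  simp only [mem_union, mem_image, mem_filter_univ, not_or, not_exists, not_and] at hγ
  have hne : ∀ {u v}, A.Adj u v → s(u, v) ≠ s(x, y) := by
    intro u v h he
    rw [Sym2.eq_iff] at he
    rcases he with ⟨rfl, rfl⟩ | ⟨rfl, rfl⟩
    exacts [hA h, hA h.symm]
  have hnew : ∀ {u v}, A.Adj u v → ∀ {w}, s(u, w) = s(x, y) → c u v ≠ γ := by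
    intro u v h w he
    rw [Sym2.eq_iff] at he
    rcases he with ⟨rfl, rfl⟩ | ⟨rfl, rfl⟩
    exacts [hγ.1 _ h, hγ.2 _ h]
  refine ⟨fun u v ↦ if s(u, v) = s(x, y) then γ else c u v, ?_, ?_, ?_⟩
  · have hadj : ∀ {u v}, (A ⊔ edge x y).Adj u v → A.Adj u v ∨ s(u, v) = s(x, y) := by
      intro u v h
      rw [sup_adj, edge_adj] at h
      rw [Sym2.eq_iff]
      tauto
    intro u v w hv hw h
    rcases hadj hv with hv | hv <;> rcases hadj hw with hw | hw
    · rw [if_neg (hne hv), if_neg (hne hw)] at h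
      exact hc.inj u v w hv hw h
    · rw [if_neg (hne hv), if_pos hw] at h
      exact absurd h (hnew hv hw)
    · rw [if_pos hv, if_neg (hne hw)] at h
      exact absurd h.symm (hnew hw hv)
    · exact Sym2.congr_right.1 (hv.trans hw.symm)
  · intro u v h
    simp only [Sym2.eq_swap (a := v) (b := u), hc.symm u v h]
  · intro i
    refine (existsUnique_congr fun p ↦ and_congr_right fun h ↦ ?_).2 (hc.dart i)
    rw [if_neg (hne (hFA h))]

theorem exists_dartColoring_cliqueOn [Fintype V] [Nonempty C] [Fintype C] (F : SimpleGraph V)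
    [Fintype F.edgeSet] (hC : Fintype.card C = 2 * #F.edgeFinset) {U : Finset V}
    (hF : F ≤ cliqueOn U) (hU : 2 * #U ≤ Fintype.card C + 2) :
    ∃ c : V → V → C, DartColoring F (cliqueOn U) c := by
  obtain ⟨A, ⟨hFA, hAU, c, hc⟩, hmax⟩ := (Set.toFinite {A : SimpleGraph V |
    F ≤ A ∧ A ≤ cliqueOn U ∧ ∃ c : V → V → C, DartColoring F A c}).exists_maximal
    ⟨F, le_rfl, hF, exists_dartColoring_self F hC⟩
  suffices A = cliqueOn U from ⟨c, this ▸ hc⟩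
  refine le_antisymm hAU fun x y hxy ↦ ?_
  by_contra hA
  have hle : A ⊔ edge x y ≤ cliqueOn U := by
    refine sup_le hAU fun u v h ↦ ?_
    rw [edge_adj] at h
    rcases h.1 with ⟨rfl, rfl⟩ | ⟨rfl, rfl⟩
    exacts [hxy, hxy.symm]
  refine hA (hmax ⟨hFA.trans le_sup_left, hle,
    hc.exists_sup_edge hFA hAU hU hxy.1 hxy.2.1 hxy.2.2 hA⟩ le_sup_left ?_)
  rw [sup_adj, edge_adj]
  exact .inr ⟨.inl ⟨rfl, rfl⟩, hxy.2.2⟩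

/-- The number of vertices of `U` at which a given colour occurs is odd. -/
theorem DartColoring.odd_card [DecidableEq V] [DecidableEq C] {F : SimpleGraph V}
    {U : Finset V} {c : V → V → C} (hc : DartColoring F (cliqueOn U) c) (hF : F ≤ cliqueOn U)
    (i : C) : Odd #{u ∈ U | i ∈ (U.erase u).image (c u)} := by
  let D : Finset (V × V) := {p ∈ U ×ˢ U | p.1 ≠ p.2 ∧ c p.1 p.2 = i}
  have hD : ∀ p, p ∈ D ↔ (cliqueOn U).Adj p.1 p.2 ∧ c p.1 p.2 = i := by
    intro p
    simp only [D, mem_filter, mem_product, cliqueOn_adj]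
    tauto
  have himage : ({u ∈ U | i ∈ (U.erase u).image (c u)} : Finset V) = D.image Prod.fst := by
    ext u
    simp only [mem_filter, mem_image, mem_erase, hD, cliqueOn_adj, Prod.exists]
    constructor
    · rintro ⟨hu, y, ⟨hyu, hy⟩, h⟩
      exact ⟨u, y, ⟨⟨hu, hy, hyu.symm⟩, h⟩, rfl⟩
    · rintro ⟨u, y, ⟨⟨hu, hy, hyu⟩, h⟩, rfl⟩
      exact ⟨hu, y, ⟨hyu.symm, hy⟩, h⟩
  rw [himage, card_image_of_injOn]
  swap
  · rintro ⟨x, y⟩ hp ⟨x', z⟩ hq h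
    obtain rfl : x = x' := h
    have hp := (hD _).1 hp
    have hq := (hD _).1 hq
    rw [hc.inj x y z hp.1 hq.1 (hp.2.trans hq.2.symm)]
  -- Exactly one dart of colour `i` lies in `F`; on the others reversal is a fixed-point-free
  -- involution.
  obtain ⟨p, ⟨hpF, hpi⟩, hp⟩ := hc.dart i
  have hpD : p ∈ D := (hD p).2 ⟨hF hpF, hpi⟩
  rw [← card_erase_add_one hpD]
  refine Even.add_one ?_
  rw [← ZMod.natCast_eq_zero_iff_even, card_eq_sum_ones, Nat.cast_sum]
  have hnotF : ∀ q ∈ D.erase p, ¬ F.Adj q.1 q.2 := fun q hq h ↦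
    (mem_erase.1 hq).1 (hp q ⟨h, ((hD q).1 (mem_erase.1 hq).2).2⟩)
  refine sum_involution (fun q _ ↦ q.swap) (fun _ _ ↦ by decide) ?_ ?_ ?_
  · intro q hq _ h
    have := ((hD q).1 (mem_erase.1 hq).2).1.ne
    exact this (congrArg Prod.snd h)
  · intro q hq
    have hqD := (hD q).1 (mem_erase.1 hq).2
    have hnF := hnotF q hq
    refine mem_erase.2 ⟨?_, (hD _).2 ⟨hqD.1.symm, ?_⟩⟩
    · rintro rfl
      exact hnF hpF.symm
    · simp only [Prod.fst_swap, Prod.snd_swap]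
      rw [← hc.symm _ _ hnF, hqD.2]
  · simp

/-- Each vertex of `U` misses exactly `k` colours, and `g` picks one of them for its edge to `w`,
using every colour that is missing at `k` vertices. By parity an unused colour is missing at no more
than `k - 2` vertices of `U`, so its absence at `w` is harmless. -/
theorem DartColoring.exists_insert [DecidableEq V] [Fintype C] [DecidableEq C]
    {F : SimpleGraph V} {U : Finset V} {c : V → V → C} (hc : DartColoring F (cliqueOn U) c)
    (hF : F ≤ cliqueOn U) (hUne : U.Nonempty) {k : ℕ} (hk : 0 < k)
    (hC : Fintype.card C + 1 = #U + k) (heven : Even (Fintype.card C))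
    (hd : ∀ i, #{u ∈ U | i ∉ (U.erase u).image (c u)} ≤ k) {w : V} (hw : w ∉ U) :
    ∃ c' : V → V → C, DartColoring F (cliqueOn (insert w U)) c' ∧
      ∀ i, #{u ∈ insert w U | i ∉ ((insert w U).erase u).image (c' u)} ≤ k - 1 := by
  have hpar : ∀ i, (#{u ∈ U | i ∉ (U.erase u).image (c u)}) % 2 = k % 2 := by
    intro i
    have h1 := hc.odd_card hF i
    have h2 := card_filter_add_card_filter_not (s := U) fun u ↦ i ∈ (U.erase u).image (c u)
    rw [Nat.odd_iff] at h1
    rw [Nat.even_iff] at heven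
    omega
  have hrow : ∀ u ∈ U, #((U.erase u).image (c u))ᶜ = k := by
    intro u hu
    rw [card_compl, card_image_of_injOn, card_erase_of_mem hu]
    · have := card_pos.2 hUne
      omega
    · intro y hy z hz h
      simp only [coe_erase, Set.mem_sdiff, mem_coe, Set.mem_singleton_iff] at hy hz
      exact hc.inj u y z ⟨hu, hy.1, Ne.symm hy.2⟩ ⟨hu, hz.1, Ne.symm hz.2⟩ h
  obtain ⟨g, hginj, hgL, hgcov⟩ := exists_injOn_covering U hUne
    (fun u ↦ ((U.erase u).image (c u))ᶜ) hk hC hrow (by simpa only [mem_compl] using hd)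
    -- For `k = 1`, the bound and parity force exactly one vertex.
    (fun h i ↦ by
      have h1 := hd i
      have h2 := hpar i
      simp only [mem_compl]
      omega)
  simp only [mem_compl] at hgL hgcov
  let c' : V → V → C := fun x y ↦ if x = w then g y else if y = w then g x else c x y
  have hwne : ∀ {u}, u ∈ U → u ≠ w := fun hu h ↦ hw (h ▸ hu)
  have hcU : ∀ {x y}, x ∈ U → y ∈ U → c' x y = c x y := fun hx hy ↦ by
    simp [c', hwne hx, hwne hy]
  have hcw : ∀ {x}, x ∈ U → c' x w = g x := fun hx ↦ by simp [c', hwne hx]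
  have hwc : ∀ {x}, c' w x = g x := by simp [c']
  have himg : ∀ u ∈ U, ((insert w U).erase u).image (c' u) =
      insert (g u) ((U.erase u).image (c u)) := by
    intro u hu
    rw [erase_insert_of_ne (hwne hu).symm, image_insert, hcw hu]
    congr 1
    exact image_congr fun y hy ↦ hcU hu (mem_of_mem_erase hy)
  have himgw : ((insert w U).erase w).image (c' w) = U.image g := by
    rw [erase_insert hw]
    exact image_congr fun y _ ↦ hwc
  refine ⟨c', ⟨?_, ?_, ?_⟩, ?_⟩
  · rintro x y z ⟨hx, hy, hxy⟩ ⟨-, hz, hxz⟩ h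
    rw [mem_insert] at hx hy hz
    rcases hx with rfl | hx
    · rw [hwc, hwc] at h
      exact hginj (hy.resolve_left hxy.symm) (hz.resolve_left hxz.symm) h
    · have hnew : ∀ t ∈ U, x ≠ t → c x t ≠ g x := fun t ht hxt he ↦
        hgL x hx (mem_image.2 ⟨t, mem_erase.2 ⟨hxt.symm, ht⟩, he⟩)
      rcases hy with rfl | hy <;> rcases hz with rfl | hz
      · rfl
      · rw [hcw hx, hcU hx hz] at h
        exact absurd h.symm (hnew z hz hxz)
      · rw [hcw hx, hcU hx hy] at h
        exact absurd h (hnew y hy hxy)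
      · rw [hcU hx hy, hcU hx hz] at h
        exact hc.inj x y z ⟨hx, hy, hxy⟩ ⟨hx, hz, hxz⟩ h
  · intro x y h
    by_cases hx : x = w <;> by_cases hy : y = w
    · simp [hx, hy]
    · simp [c', hx, hy]
    · simp [c', hx, hy]
    · simp [c', hx, hy, hc.symm x y h]
  · intro i
    refine (existsUnique_congr fun p ↦ and_congr_right fun h ↦ ?_).2 (hc.dart i)
    rw [hcU (hF h).1 (hF h).2.1]
  · intro i
    by_cases hi : ∃ u ∈ U, g u = i
    · obtain ⟨u, hu, rfl⟩ := hi
      have hsub : ({v ∈ insert w U | g u ∉ ((insert w U).erase v).image (c' v)} : Finset V) ⊆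
          ({v ∈ U | g u ∉ (U.erase v).image (c v)} : Finset V).erase u := by
        intro v hv
        rw [mem_filter, mem_insert] at hv
        obtain ⟨rfl | hvU, hv⟩ := hv
        · rw [himgw] at hv
          exact absurd (mem_image_of_mem g hu) hv
        · rw [himg v hvU, mem_insert, not_or] at hv
          refine mem_erase.2 ⟨?_, mem_filter.2 ⟨hvU, hv.2⟩⟩
          rintro rfl
          exact hv.1 rfl
      refine (card_le_card hsub).trans ?_
      rw [card_erase_of_mem (mem_filter.2 ⟨hu, hgL u hu⟩)]
      have := hd (g u)
      omega
    · have hlt : #{u ∈ U | i ∉ (U.erase u).image (c u)} ≠ k := fun h ↦ hi (hgcov i h)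
      have hsub : ({v ∈ insert w U | i ∉ ((insert w U).erase v).image (c' v)} : Finset V) ⊆
          insert w ({v ∈ U | i ∉ (U.erase v).image (c v)} : Finset V) := by
        intro v hv
        rw [mem_filter, mem_insert] at hv
        obtain ⟨rfl | hvU, hv⟩ := hv
        · exact mem_insert_self _ _
        · rw [himg v hvU, mem_insert, not_or] at hv
          exact mem_insert_of_mem (mem_filter.2 ⟨hvU, hv.2⟩)
      have h1 := (card_le_card hsub).trans (card_insert_le _ _)
      have h2 := hd i
      have h3 := hpar i
      omega

/-- Deleting `m` edges that span at most `m + 1` vertices from the complete graph on `2 * m + 1`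
vertices leaves a graph whose edges can be coloured with `2 * m` colours. -/
theorem exists_dartColoring_top [Fintype V] [Fintype C] [Nonempty C]
    (F : SimpleGraph V) [Fintype F.edgeSet] (hC : Fintype.card C = 2 * #F.edgeFinset)
    (hV : Fintype.card V = Fintype.card C + 1) {U : Finset V} (hF : F ≤ cliqueOn U)
    (hUne : U.Nonempty) (hU : #U ≤ #F.edgeFinset + 1) :
    ∃ c : V → V → C, DartColoring F ⊤ c := by
  classical
  have heven : Even (Fintype.card C) := ⟨_, hC.trans (two_mul _)⟩
  have hmono : ∀ {W : Finset V}, U ⊆ W → F ≤ cliqueOn W := fun h x y hxy ↦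
    ⟨h (hF hxy).1, h (hF hxy).2.1, hxy.ne⟩
  have key : ∀ j : ℕ, #U + j ≤ Fintype.card V → ∃ W : Finset V, U ⊆ W ∧ #W = #U + j ∧
      ∃ c : V → V → C, DartColoring F (cliqueOn W) c ∧
        ∀ i, #{u ∈ W | i ∉ (W.erase u).image (c u)} ≤ Fintype.card V - #W := by
    intro j
    induction j with
    | zero =>
      intro _
      obtain ⟨c, hc⟩ := exists_dartColoring_cliqueOn (C := C) F hC hF (by omega)
      refine ⟨U, subset_rfl, rfl, c, hc, fun i ↦ ?_⟩
      -- An odd count is positive, so each colour is missing at no more than `#U - 1` vertices, and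
      -- `hU` bounds this by `card V - #U`.
      have h1 := (hc.odd_card hF i).pos
      have h2 := card_filter_add_card_filter_not (s := U) fun u ↦ i ∈ (U.erase u).image (c u)
      omega
    | succ j ih =>
      intro hj
      obtain ⟨W, hUW, hW, c, hc, hd⟩ := ih (by omega)
      obtain ⟨w, hw⟩ : ∃ w, w ∉ W := by
        by_contra! h
        have := card_le_card (fun i _ ↦ h i : (univ : Finset V) ⊆ W)
        rw [card_univ] at this
        omega
      obtain ⟨c', hc', hd'⟩ := hc.exists_insert (hmono hUW) (hUne.mono hUW)
        (k := Fintype.card V - #W) (by omega) (by omega) heven hd hw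
      refine ⟨insert w W, hUW.trans (subset_insert _ _), ?_, c', hc', fun i ↦ ?_⟩
      · rw [card_insert_of_notMem hw]
        omega
      · refine (hd' i).trans ?_
        rw [card_insert_of_notMem hw]
        omega
  have hUV := card_le_univ U
  obtain ⟨W, -, hW, c, hc, -⟩ := key (Fintype.card V - #U) (by omega)
  have hWu : W = univ := by
    rw [← card_eq_iff_eq_univ]
    omega
  subst hWu
  refine ⟨c, fun x y z hy hz h ↦ hc.inj x y z ⟨mem_univ _, mem_univ _, hy.ne⟩
    ⟨mem_univ _, mem_univ _, hz.ne⟩ h, hc.symm, hc.dart⟩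

end DartColoring

/-! ### Edge colourings of complete graphs, near-complete graphs and graphs with pendant edges. -/

section EdgeColoring

open Finset SimpleGraph

variable {C : Type*}

/-- A proper edge colouring, given as a function of the two ends of an edge. -/
structure IsEdgeColoring (G : SimpleGraph V) (c : V → V → C) : Prop where
  symm : ∀ x y, G.Adj x y → c x y = c y x
  inj : ∀ x y z, G.Adj x y → G.Adj x z → c x y = c x z → y = z

theorem IsEdgeColoring.mono {G H : SimpleGraph V} {c : V → V → C} (hc : IsEdgeColoring H c)
    (h : G ≤ H) : IsEdgeColoring G c :=
  ⟨fun x y hxy ↦ hc.symm x y (h hxy), fun x y z hy hz ↦ hc.inj x y z (h hy) (h hz)⟩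

theorem IsEdgeColoring.comp {D : Type*} {G : SimpleGraph V} {c : V → V → C}
    (hc : IsEdgeColoring G c) {f : C → D} (hf : Function.Injective f) :
    IsEdgeColoring G fun x y ↦ f (c x y) :=
  ⟨fun x y h ↦ congrArg f (hc.symm x y h), fun x y z hy hz h ↦ hc.inj x y z hy hz (hf h)⟩

theorem IsEdgeColoring.colorable_lineGraph {G : SimpleGraph V} {n : ℕ} {c : V → V → Fin n}
    (hc : IsEdgeColoring G c) : G.lineGraph.Colorable n := by
  have hout : ∀ e : Sym2 V, s(e.out.1, e.out.2) = e := fun e ↦ Quot.out_eq e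
  have hval : ∀ {e : Sym2 V} {w a : V}, e ∈ G.edgeSet → e = s(w, a) →
      c e.out.1 e.out.2 = c w a := by
    intro e w a he h
    have h1 := (hout e).trans h
    rw [h, mem_edgeSet] at he
    rw [Sym2.eq_iff] at h1
    rcases h1 with ⟨h1, h2⟩ | ⟨h1, h2⟩
    · rw [h1, h2]
    · rw [h1, h2, hc.symm w a he]
  refine ⟨Coloring.mk (fun e ↦ c e.1.out.1 e.1.out.2) ?_⟩
  rintro ⟨e₁, h₁⟩ ⟨e₂, h₂⟩ hadj heq
  obtain ⟨hne, w, hw₁, hw₂⟩ := lineGraph_adj_iff_exists.1 hadj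
  obtain ⟨a, ha⟩ := Sym2.mem_iff_exists.1 hw₁
  obtain ⟨b, hb⟩ := Sym2.mem_iff_exists.1 hw₂
  simp only [hval h₁ ha, hval h₂ hb] at heq
  simp only at ha hb
  subst ha hb
  have := hc.inj w a b h₁ h₂ heq
  exact hne (by simp [this])

theorem exists_isEdgeColoring_top_of_card_le [Fintype V] {n : ℕ} (hn : 0 < n)
    (h : Fintype.card V ≤ n) : ∃ c : V → V → Fin n, IsEdgeColoring ⊤ c := by
  have : NeZero n := ⟨hn.ne'⟩
  obtain ⟨f⟩ : Nonempty (V ↪ ZMod n) :=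
    Function.Embedding.nonempty_of_card_le (by rwa [ZMod.card])
  have hf : IsEdgeColoring (⊤ : SimpleGraph V) fun x y ↦ f x + f y :=
    ⟨fun x y _ ↦ add_comm _ _, fun x y z _ _ h ↦ f.injective (add_left_cancel h)⟩
  exact ⟨_, hf.comp (ZMod.finEquiv n).symm.injective⟩

/-- Under the colouring of `ab` by `a + b` in `ZMod n`, vertex `a` misses the colour `a + a`, which
is free for its edge to the extra point `none`. As `n` is odd, doubling is injective. -/
theorem exists_isEdgeColoring_top_of_odd [Fintype V] {n : ℕ} (hn : Odd n)
    (h : Fintype.card V = n + 1) : ∃ c : V → V → Fin n, IsEdgeColoring ⊤ c := by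
  have : NeZero n := ⟨hn.pos.ne'⟩
  obtain ⟨f⟩ : Nonempty (V ≃ Option (ZMod n)) :=
    Fintype.card_eq.1 (by rw [Fintype.card_option, ZMod.card, h])
  let g : Option (ZMod n) → Option (ZMod n) → ZMod n := fun a b ↦
    match a, b with
    | some a, some b => a + b
    | some a, none => a + a
    | none, some b => b + b
    | none, none => 0
  have h2 : ∀ a b : ZMod n, a + a = b + b → a = b := by
    intro a b hab
    have hu : IsUnit ((2 : ℕ) : ZMod n) := (ZMod.isUnit_iff_coprime 2 n).2 hn.coprime_two_left
    apply hu.mul_left_cancel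
    push_cast
    rw [two_mul, two_mul, hab]
  have hg : IsEdgeColoring (⊤ : SimpleGraph V) fun x y ↦ g (f x) (f y) := by
    refine ⟨fun x y _ ↦ ?_, fun x y z hy hz h ↦ ?_⟩
    · rcases f x with _ | a <;> rcases f y with _ | b <;> simp [g, add_comm]
    · rw [top_adj, ← f.injective.ne_iff] at hy hz
      apply f.injective
      generalize f x = a at *
      generalize f y = b at *
      generalize f z = d at *
      rcases a with _ | a <;> rcases b with _ | b <;> rcases d with _ | d <;>
        simp only [g, ne_eq, not_true_eq_false, Option.some.injEq, add_right_inj] at hy hz h ⊢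
      · exact h2 _ _ h
      · exact absurd h hz
      · exact absurd h.symm hy
      · exact h
  exact ⟨_, hg.comp (ZMod.finEquiv n).symm.injective⟩

/-- A graph whose edges all meet a given clique is connected up to isolated vertices, so it has
subgraphs with `m` edges on at most `m + 1` vertices. -/
theorem exists_le_card_edgeFinset_eq [Fintype V] [DecidableEq V] (J : SimpleGraph V)
    [Fintype J.edgeSet] {S : Set V} (hS : J.IsClique S) (hJ : ∀ x y, J.Adj x y → x ∈ S ∨ y ∈ S)
    {s₀ : V} (hs₀ : s₀ ∈ S) (m : ℕ) (hm : m ≤ #J.edgeFinset) :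
    ∃ F : SimpleGraph V, ∃ _ : Fintype F.edgeSet, F ≤ J ∧ #F.edgeFinset = m ∧
      ∃ U : Finset V, F ≤ cliqueOn U ∧ s₀ ∈ U ∧ #U ≤ m + 1 := by
  classical
  induction m with
  | zero => exact ⟨⊥, inferInstance, bot_le, by simp, {s₀}, bot_le, by simp, by simp⟩
  | succ m ih =>
    obtain ⟨F, iF, hFJ, hF, U, hFU, hsU, hU⟩ := ih (by omega)
    obtain ⟨x, y, hxy, hnF, hxU⟩ : ∃ x y, J.Adj x y ∧ ¬ F.Adj x y ∧ x ∈ U := by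
      -- Otherwise all edges of `J` outside `F` avoid `U`. Since `s₀` is joined to the rest of `S`,
      -- this gives `S ⊆ U`; but edges of `J` meet `S`, so none lies outside `F`, against the count.
      by_contra! h
      have hJF : J ≤ F := by
        intro x y hxy
        by_contra hnF
        have hx : x ∉ U := h x y hxy hnF
        have hy : y ∉ U := h y x hxy.symm fun h' ↦ hnF h'.symm
        have key : ∀ z ∈ S, z ∉ U → False := fun z hz hzU ↦
          h s₀ z (hS hs₀ hz fun h' ↦ hzU (h' ▸ hsU)) (fun h' ↦ hzU (hFU h').2.1) hsU
        exact (hJ x y hxy).elim (fun hx' ↦ key x hx' hx) fun hy' ↦ key y hy' hy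
      have := card_le_card (edgeFinset_subset_edgeFinset.2 hJF)
      omega
    have hle : edge x y ≤ J := by
      rw [edge_le_iff]
      exact .inr hxy
    refine ⟨F ⊔ edge x y, Fintype.ofFinite _, sup_le hFJ hle, ?_, insert y U, ?_,
      mem_insert_of_mem hsU, (card_insert_le _ _).trans (by omega)⟩
    · rw [← hF]
      convert card_edgeFinset_sup_edge F hnF hxy.ne
    · refine sup_le (fun a b hab ↦ ?_) ?_
      · exact ⟨mem_insert_of_mem (hFU hab).1, mem_insert_of_mem (hFU hab).2.1, hab.ne⟩
      · rw [edge_le_iff]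
        exact .inr ⟨mem_insert_of_mem hxU, mem_insert_self _ _, hxy.ne⟩

theorem card_edgeFinset_add_compl [Fintype V] [DecidableEq V] (G : SimpleGraph V)
    [DecidableRel G.Adj] :
    2 * (#G.edgeFinset + #Gᶜ.edgeFinset) = Fintype.card V * (Fintype.card V - 1) := by
  rw [mul_add, ← sum_degrees_eq_twice_card_edges, ← sum_degrees_eq_twice_card_edges,
    ← sum_add_distrib, ← card_univ, ← smul_eq_mul, ← sum_const]
  refine sum_congr rfl fun v _ ↦ ?_
  have := G.degree_lt_card_verts v
  rw [degree_compl, card_univ]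
  omega

/-- A graph of odd order `2 * m + 1` with at most `2 * m * m` edges whose complement consists of a
clique and edges meeting it can be edge-coloured with `2 * m` colours. -/
theorem exists_isEdgeColoring_of_card_edgeFinset_le [Fintype V] [DecidableEq V]
    (G : SimpleGraph V) [DecidableRel G.Adj] {m : ℕ} (hm : 0 < m)
    (hV : Fintype.card V = 2 * m + 1) (hE : #G.edgeFinset ≤ 2 * m * m) {S : Set V}
    (hS : G.IsIndepSet S) (hG : ∀ x y, x ≠ y → ¬ G.Adj x y → x ∈ S ∨ y ∈ S) :
    ∃ c : V → V → Fin (2 * m), IsEdgeColoring G c := by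
  have : Nonempty (Fin (2 * m)) := ⟨⟨0, by omega⟩⟩
  -- The complete graph has `2 * m * m + m` edges.
  have hcard : m ≤ #Gᶜ.edgeFinset := by
    have := card_edgeFinset_add_compl G
    rw [hV, Nat.add_sub_cancel] at this
    nlinarith
  have hG' : ∀ x y, Gᶜ.Adj x y → x ∈ S ∨ y ∈ S := fun x y h ↦ hG x y h.1 h.2
  obtain ⟨e, he⟩ : Gᶜ.edgeFinset.Nonempty := card_pos.1 (hm.trans_le hcard)
  obtain ⟨s₀, hs₀⟩ : S.Nonempty := by
    induction e with
    | _ x y =>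
      rw [mem_edgeFinset, mem_edgeSet] at he
      rcases hG' x y he with h | h
      exacts [⟨x, h⟩, ⟨y, h⟩]
  obtain ⟨F, iF, hFG, hF, U, hFU, hsU, hU⟩ := exists_le_card_edgeFinset_eq Gᶜ
    (fun x hx y hy hxy ↦ ⟨hxy, hS hx hy hxy⟩) hG' hs₀ m hcard
  obtain ⟨c, hc⟩ := exists_dartColoring_top (C := Fin (2 * m)) F (by simp [hF])
    (by simp [hV]) hFU ⟨s₀, hsU⟩ (by omega)
  exact ⟨c, fun x y h ↦ hc.symm x y fun h' ↦ (hFG h').2 h,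
    fun x y z hy hz ↦ hc.inj x y z hy.ne hz.ne⟩

/-- Pendant edges do not affect whether a graph can be edge-coloured with at least as many colours
as its maximum degree. -/
theorem exists_isEdgeColoring_of_pendant [Fintype V] [Fintype C] (G : SimpleGraph V)
    [DecidableRel G.Adj] (hC : G.maxDegree ≤ Fintype.card C) {W : Finset V}
    (hW : ∀ u ∉ W, ∀ a b, G.Adj u a → G.Adj u b → a = b) {c : V → V → C}
    (hc : IsEdgeColoring (G ⊓ cliqueOn W) c) : ∃ c : V → V → C, IsEdgeColoring G c := by
  classical
  obtain ⟨X, ⟨hWX, c, hc⟩, hmax⟩ := (Set.toFinite {X : Finset V |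
    W ⊆ X ∧ ∃ c : V → V → C, IsEdgeColoring (G ⊓ cliqueOn X) c}).exists_maximal
    ⟨W, subset_rfl, c, hc⟩
  suffices X = univ by
    subst this
    exact ⟨c, hc.mono fun x y h ↦ ⟨h, mem_univ _, mem_univ _, h.ne⟩⟩
  rw [eq_univ_iff_forall]
  intro p
  by_contra hp
  refine hp (hmax ⟨hWX.trans (subset_insert p X), ?_⟩ (subset_insert p X) (mem_insert_self p X))
  by_cases hq : ∃ q, G.Adj p q
  swap
  · refine ⟨c, hc.mono fun x y ⟨h, hx, hy, hne⟩ ↦ ⟨h, ?_, ?_, hne⟩⟩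
    · exact mem_of_mem_insert_of_ne hx fun hxp ↦ hq ⟨y, hxp ▸ h⟩
    · exact mem_of_mem_insert_of_ne hy fun hyp ↦ hq ⟨x, hyp ▸ h.symm⟩
  obtain ⟨q, hpq⟩ := hq
  have huniq : ∀ a, G.Adj p a → a = q := fun a ha ↦ hW p (fun h ↦ hp (hWX h)) a q ha hpq
  -- The edges at `q` other than `pq` number less than Δ, so they leave a colour free.
  obtain ⟨γ, hγ⟩ : ∃ γ, γ ∉ ((G.neighborFinset q).erase p).image (c q) := by
    by_contra! h
    have h1 := card_le_card (fun i _ ↦ h i : (univ : Finset C) ⊆ _)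
    have h2 := h1.trans card_image_le
    rw [card_univ, card_erase_of_mem (by simpa using hpq.symm), card_neighborFinset_eq_degree] at h2
    have h3 := G.degree_le_maxDegree q
    have h4 : 0 < G.degree q := (G.degree_pos_iff_exists_adj q).2 ⟨p, hpq.symm⟩
    omega
  have hγ' : ∀ y, G.Adj q y → y ≠ p → c q y ≠ γ := fun y hy hyp h ↦
    hγ (mem_image.2 ⟨y, mem_erase.2 ⟨hyp, by simpa using hy⟩, h⟩)
  refine ⟨fun x y ↦ if x = p ∨ y = p then γ else c x y, ?_, ?_⟩
  · rintro x y ⟨h, hx, hy, hne⟩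
    by_cases h1 : x = p <;> by_cases h2 : y = p <;> simp only [h1, h2, or_true, or_false,
      if_true, if_false]
    exact hc.symm x y ⟨h, mem_of_mem_insert_of_ne hx h1, mem_of_mem_insert_of_ne hy h2, hne⟩
  · rintro x y z ⟨hy, hx, hyX, hxy⟩ ⟨hz, -, hzX, hxz⟩ h
    by_cases hxp : x = p
    · subst hxp
      rw [huniq y hy, huniq z hz]
    by_cases hyp : y = p <;> by_cases hzp : z = p
    · rw [hyp, hzp]
    · subst hyp
      obtain rfl := huniq x hy.symm
      simp only [hxp, hzp, or_true, or_false, if_true, if_false] at h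
      exact absurd h.symm (hγ' z hz hzp)
    · subst hzp
      obtain rfl := huniq x hz.symm
      simp only [hxp, hyp, or_true, or_false, if_true, if_false] at h
      exact absurd h (hγ' y hy hyp)
    · simp only [hxp, hyp, hzp, or_false, if_false] at h
      have hx := mem_of_mem_insert_of_ne hx hxp
      exact hc.inj x y z ⟨hy, hx, mem_of_mem_insert_of_ne hyX hyp, hxy⟩
        ⟨hz, hx, mem_of_mem_insert_of_ne hzX hzp, hxz⟩ h

end EdgeColoring

/-! ### Overfull subgraphs and the colouring with Δ colours. -/

section Overfull

open Finset SimpleGraph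

/-- A colour class is a matching: its edges have disjoint pairs of ends, so it has at most half as
many edges as there are vertices. -/
theorem card_edgeFinset_le_of_colorable_lineGraph [Fintype V] [DecidableEq V] (G : SimpleGraph V)
    [DecidableRel G.Adj] {n : ℕ} (h : G.lineGraph.Colorable n) :
    #G.edgeFinset ≤ n * (Fintype.card V / 2) := by
  obtain ⟨c⟩ := h
  rw [edgeFinset_card, ← card_univ,
    card_eq_sum_card_fiberwise (f := c) (t := univ) fun _ _ ↦ by simp]
  refine (sum_le_card_nsmul univ _ (Fintype.card V / 2) fun i _ ↦ ?_).trans (by simp)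
  rw [Nat.le_div_iff_mul_le two_pos]
  calc #{e | c e = i} * 2 = ∑ e with c e = i, #(e : Sym2 V).toFinset := by
        rw [← smul_eq_mul, ← sum_const]
        exact sum_congr rfl fun e _ ↦
          (Sym2.card_toFinset_of_not_isDiag _ (G.not_isDiag_of_mem_edgeSet e.2)).symm
    _ = #(({e | c e = i} : Finset G.edgeSet).biUnion fun e ↦ (e : Sym2 V).toFinset) := by
        refine (card_biUnion fun e he f hf hne ↦ ?_).symm
        rw [Function.onFun, Finset.disjoint_left]
        intro w hw hw'
        rw [mem_coe, mem_filter_univ] at he hf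
        refine c.valid (lineGraph_adj_iff_exists.2 ⟨hne, w, ?_, ?_⟩) (he.trans hf.symm)
        · simpa using hw
        · simpa using hw'
    _ ≤ Fintype.card V := card_le_univ _

theorem isOverfull_iff [Fintype V] {G : SimpleGraph V} [DecidableRel G.Adj] [Fintype G.edgeSet] :
    IsOverfull G ↔ G.maxDegree * (Fintype.card V / 2) < #G.edgeFinset := by
  unfold IsOverfull
  rw [gt_iff_lt]
  congr!

theorem isClassTwo_of_isSubgraphOverfull [Fintype V] {G : SimpleGraph V}
    (h : IsSubgraphOverfull G) : IsClassTwo G := by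
  classical
  obtain ⟨H, hdeg, hover⟩ := h
  intro hG
  have hH : H.coe.lineGraph.Colorable G.maxDegree := by
    obtain ⟨f⟩ := H.coe_isContained.lineGraph
    refine Colorable.of_hom f.toHom ?_
    unfold IsClassOne at hG
    convert hG
  have hle := card_edgeFinset_le_of_colorable_lineGraph _ hH
  rw [isOverfull_iff, ← not_le] at hover
  refine hover (hle.trans_eq ?_)
  rw [← hdeg]

theorem maxDegree_congr_instances (G : SimpleGraph V) (i j : Fintype V) (d e : DecidableRel G.Adj) :
    @maxDegree V G i d = @maxDegree V G j e := by
  rw [Subsingleton.elim i j, Subsingleton.elim d e]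

theorem isSubgraphOverfull_of_induce [Fintype V] {G : SimpleGraph V} [DecidableRel G.Adj]
    (s : Set V) [Fintype s] [DecidableRel (G.induce s).Adj]
    (hdeg : (G.induce s).maxDegree = G.maxDegree)
    (h : G.maxDegree * (Fintype.card s / 2) < #(G.induce s).edgeFinset) :
    IsSubgraphOverfull G := by
  classical
  have hmax : ∀ (K : SimpleGraph s) (i : Fintype s) (d : DecidableRel K.Adj), K = G.induce s →
      @maxDegree s K i d = G.maxDegree := by
    rintro _ i d rfl
    rw [← hdeg]
    exact maxDegree_congr_instances _ _ _ _ _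
  rw [← hdeg, ← isOverfull_iff] at h
  have hover : ∀ (K : SimpleGraph s) (i : Fintype s), K = G.induce s → @IsOverfull s i K := by
    rintro _ i rfl
    convert h
  exact ⟨(⊤ : G.Subgraph).induce s,
    (hmax _ _ _ (induce_eq_coe_induce_top s).symm).trans (maxDegree_congr_instances _ _ _ _ _),
    hover _ _ (induce_eq_coe_induce_top s).symm⟩

theorem exists_isEdgeColoring_inf_cliqueOn [DecidableEq V] {C : Type*} [Nonempty C]
    {G : SimpleGraph V} {W : Finset V} {c : W → W → C}
    (hc : IsEdgeColoring (G.induce (W : Set V)) c) :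
    ∃ c : V → V → C, IsEdgeColoring (G ⊓ cliqueOn W) c := by
  let d : V → V → C := fun x y ↦
    if h : x ∈ W ∧ y ∈ W then c ⟨x, h.1⟩ ⟨y, h.2⟩ else Classical.arbitrary C
  have hd : ∀ {x y} (hx : x ∈ W) (hy : y ∈ W), d x y = c ⟨x, hx⟩ ⟨y, hy⟩ := fun hx hy ↦ by
    simp [d, hx, hy]
  refine ⟨d, ?_, ?_⟩
  · rintro x y ⟨h, hx, hy, -⟩
    rw [hd hx hy, hd hy hx]
    exact hc.symm _ _ h
  · rintro x y z ⟨hy, hx, hyW, -⟩ ⟨hz, -, hzW, -⟩ h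
    rw [hd hx hyW, hd hx hzW] at h
    exact congrArg Subtype.val (hc.inj ⟨x, hx⟩ ⟨y, hyW⟩ ⟨z, hzW⟩ hy hz h)

/-- The edges of a split graph that has a universal vertex up to vertices of degree one and is not
subgraph-overfull can be coloured with `Δ(G)` colours. -/
theorem exists_isEdgeColoring_maxDegree [Fintype V] {G : SimpleGraph V} [DecidableRel G.Adj]
    (hsplit : IsSplit G) {v : V}
    (hv : ∀ u, u = v ∨ G.Adj v u ∨ ∀ a b, G.Adj u a → G.Adj u b → a = b)
    (hΔ : 0 < G.maxDegree) (hover : ¬ IsSubgraphOverfull G) :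
    ∃ c : V → V → Fin G.maxDegree, IsEdgeColoring G c := by
  classical
  have : Nonempty (Fin G.maxDegree) := ⟨⟨0, hΔ⟩⟩
  let W : Finset V := insert v (G.neighborFinset v)
  have hvW : v ∈ W := mem_insert_self _ _
  have hWadj : ∀ {u}, u ∈ W → u ≠ v → G.Adj v u := fun hu hne ↦ by
    simpa using mem_of_mem_insert_of_ne hu hne
  have hW : #W = G.degree v + 1 := by
    rw [card_insert_of_notMem (by simp), card_neighborFinset_eq_degree]
  have hpend : ∀ u ∉ W, ∀ a b, G.Adj u a → G.Adj u b → a = b := by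
    intro u hu
    simp only [W, mem_insert, mem_neighborFinset, not_or] at hu
    exact ((hv u).resolve_left hu.1).resolve_left hu.2
  have hdv := G.degree_le_maxDegree v
  suffices ∃ c : W → W → Fin G.maxDegree, IsEdgeColoring (G.induce (W : Set V)) c by
    obtain ⟨c, hc⟩ := this
    obtain ⟨c', hc'⟩ := exists_isEdgeColoring_inf_cliqueOn hc
    exact exists_isEdgeColoring_of_pendant G (by simp) hpend hc'
  by_cases hlt : G.degree v < G.maxDegree
  · obtain ⟨c, hc⟩ := exists_isEdgeColoring_top_of_card_le (V := W) hΔ (by simp [hW]; omega)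
    exact ⟨c, hc.mono le_top⟩
  have heq : G.degree v = G.maxDegree := by omega
  rcases Nat.even_or_odd G.maxDegree with heven | hodd
  swap
  · obtain ⟨c, hc⟩ := exists_isEdgeColoring_top_of_odd (V := W) hodd (by simp [hW, heq])
    exact ⟨c, hc.mono le_top⟩
  obtain ⟨m, hm⟩ := heven.two_dvd
  -- All of the Δ neighbours of `v` lie in `W`, so G[W] keeps the maximum degree and would witness
  -- subgraph-overfullness.
  have hdeg : (G.induce (W : Set V)).maxDegree = G.maxDegree := by
    refine le_antisymm (maxDegree_le_of_forall_degree_le _ _ fun u ↦ ?_) ?_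
    · refine le_trans ?_ (G.degree_le_maxDegree u)
      rw [← card_neighborFinset_eq_degree, ← card_neighborFinset_eq_degree]
      refine card_le_card_of_injOn Subtype.val (fun x hx ↦ ?_) Subtype.val_injective.injOn
      simpa using hx
    · refine le_trans ?_ (degree_le_maxDegree _ (⟨v, hvW⟩ : (W : Set V)))
      have : (G.induce (W : Set V)).neighborFinset ⟨v, hvW⟩ = univ.erase ⟨v, hvW⟩ := by
        ext ⟨u, hu⟩
        simp only [mem_neighborFinset, comap_adj, mem_erase, mem_univ, and_true, ne_eq,
          Subtype.mk.injEq, Function.Embedding.subtype_apply]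
        exact ⟨fun h ↦ h.ne', fun h ↦ hWadj hu h⟩
      rw [← card_neighborFinset_eq_degree, this, card_erase_of_mem (mem_univ _), card_univ]
      simp [hW, heq]
  obtain ⟨X, hX, hXc⟩ := hsplit
  have hle : #(G.induce (W : Set V)).edgeFinset ≤ 2 * m * m := by
    by_contra! h
    refine hover (isSubgraphOverfull_of_induce (W : Set V) hdeg ?_)
    have hcW : Fintype.card (W : Set V) = 2 * m + 1 := by simp [hW, heq, hm]
    rwa [hcW, hm, (by omega : (2 * m + 1) / 2 = m)]
  obtain ⟨c, hc⟩ := exists_isEdgeColoring_of_card_edgeFinset_le (G.induce (W : Set V)) (m := m)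
    (by omega) (by simp [hW, heq, hm]) hle (S := {x | (x : V) ∉ X})
    (fun x hx y hy hne ↦ hXc hx hy (Subtype.val_injective.ne hne))
    (fun x y hne hadj ↦ by
      by_contra! h
      simp only [Set.mem_ofPred_eq, not_not] at h
      exact hadj (hX h.1 h.2 (Subtype.val_injective.ne hne)))
  rw [hm]
  exact ⟨c, hc⟩

end Overfull

end SplitEdgeColoring

theorem mainTheorem8 {V : Type*} [Fintype V] (G : SimpleGraph V) (hconn : G.Connected)
    (hsplit : SplitEdgeColoring.IsSplit G) (hstretch : SplitEdgeColoring.stretchIndex G = 2) :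
    SplitEdgeColoring.IsClassTwo G ↔ SplitEdgeColoring.IsSubgraphOverfull G := by
  classical
  refine ⟨fun h ↦ ?_, SplitEdgeColoring.isClassTwo_of_isSubgraphOverfull⟩
  by_contra hover
  refine h ?_
  suffices G.lineGraph.Colorable G.maxDegree by
    unfold SplitEdgeColoring.IsClassOne
    convert this
  have hadm : SplitEdgeColoring.IsAdmissible G 2 := by
    -- The infimum of the empty set is 0, so the value 2 is attained.
    have hne : {t : ℕ | SplitEdgeColoring.IsAdmissible G t}.Nonempty := by
      rw [Set.nonempty_iff_ne_empty]
      intro hempty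
      simp [SplitEdgeColoring.stretchIndex, hempty] at hstretch
    have := Nat.sInf_mem hne
    rwa [← SplitEdgeColoring.stretchIndex, hstretch] at this
  obtain ⟨v, hv⟩ := SplitEdgeColoring.exists_almost_universal hsplit hadm
  rcases Nat.eq_zero_or_pos G.maxDegree with h0 | hpos
  · have : IsEmpty G.edgeSet := by
      refine ⟨fun ⟨e, he⟩ ↦ ?_⟩
      induction e with
      | _ x y =>
        have h1 := (G.degree_pos_iff_exists_adj x).2 ⟨y, he⟩
        have h2 := G.degree_le_maxDegree x
        omega
    exact SimpleGraph.Colorable.of_isEmpty _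
  · obtain ⟨c, hc⟩ := SplitEdgeColoring.exists_isEdgeColoring_maxDegree hsplit hv hpos hover
    exact hc.colorable_lineGraph
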